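/- A rooted plane tree consists of a root and a (possibly empty) ordered list of branches, each of which is again a rooted plane tree; its size is its number of vertices, and a leaf is a vertex without children. The protection number of a vertex $v$ is the minimum distance of $v$ from a leaf in the maximal subtree rooted at $v$ (so a leaf has protection number $0$), and $v$ is $k$-protected if its protection number is at least $k$. For $n \ge 1$ let $Y_n$ be the protection number of a uniformly chosen vertex of a uniformly chosen random rooted plane tree with $n$ vertices. **Proposition.** The probability that a random vertex of a random tree with $n$ vertices is $k$-protected is $$\mathbb{P}(Y_n \ge k) = \frac{3}{4^k+2} + \frac{(3k-10)4^{2k} + (6k+26)4^k - 16}{2(4^k+2)^3}\cdot\frac{1}{n} + O\Bigl(\frac{k^2}{3^k n^2}\Bigr),$$ where the implied constant is absolute, i.e. the estimate holds uniformly for all integers $n \ge 1$ and $k \ge 0$. -/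

import Mathlib

/-- Rooted plane trees: a root together with the ordered list of its branches. -/
inductive PlaneTree : Type
  | node (children : List PlaneTree) : PlaneTree

namespace PlaneTree

/-- The maximal (fringe) subtrees of `t` in preorder, one entry for each vertex of `t`: the entry
of a vertex `v` is the subtree that consists of `v` and all its descendants. Equal subtrees
rooted at different vertices are listed separately. -/
def subtrees : PlaneTree → List PlaneTree
  | node cs => node cs :: cs.flatMap subtrees

/-- The size of a tree: its number of vertices. -/
def size (t : PlaneTree) : ℕ := t.subtrees.length

/-- `LeafAtDist t d`: some leaf (vertex without children) of `t` has distance `d` from the root. -/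
inductive LeafAtDist : PlaneTree → ℕ → Prop
  | leaf : LeafAtDist (node []) 0
  | child (cs : List PlaneTree) (c : PlaneTree) (d : ℕ) (hc : c ∈ cs) (h : LeafAtDist c d) :
      LeafAtDist (node cs) (d + 1)

/-- The protection number of (the root of) a tree: the minimum distance of the root from a leaf. -/
noncomputable def protection (t : PlaneTree) : ℕ := sInf {d : ℕ | LeafAtDist t d}

theorem size_node (cs : List PlaneTree) : size (node cs) = 1 + (cs.map size).sum := by
  unfold size
  rw [subtrees, List.length_cons, List.length_flatMap, add_comm]

theorem finite_forests (m : ℕ) : {cs : List PlaneTree | (cs.map size).sum = m}.Finite := by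
  induction m using Nat.strong_induction_on with
  | _ m ih =>
    have hfin : (⋃ i : Fin m, ⋃ j : Fin m,
        Set.image2 (fun cs rest => node cs :: rest)
          {cs : List PlaneTree | (cs.map size).sum = i}
          {cs : List PlaneTree | (cs.map size).sum = j}).Finite :=
      Set.finite_iUnion fun i => Set.finite_iUnion fun j =>
        Set.Finite.image2 _ (ih i i.2) (ih j j.2)
    refine (hfin.insert []).subset ?_
    rintro (_ | ⟨⟨cs⟩, rest⟩) h
    · exact Set.mem_insert _ _
    · right
      simp only [Set.mem_ofPred_eq, List.map_cons, List.sum_cons, size_node] at h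
      simp only [Set.mem_iUnion]
      have h1 : (cs.map size).sum < m := by omega
      have h2 : (rest.map size).sum < m := by omega
      exact ⟨⟨_, h1⟩, ⟨_, h2⟩, Set.mem_image2_of_mem rfl rfl⟩

theorem finite_size (n : ℕ) : {t : PlaneTree | t.size = n}.Finite := by
  refine ((finite_forests (n - 1)).image node).subset ?_
  rintro ⟨cs⟩ h
  refine ⟨cs, ?_, rfl⟩
  simp only [Set.mem_ofPred_eq, size_node] at h ⊢
  omega

/-- The finite set of all rooted plane trees with `n` vertices. -/
noncomputable def treesOfSize (n : ℕ) : Finset PlaneTree := (finite_size n).toFinset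

theorem treesOfSize_nonempty (n : ℕ) (hn : 0 < n) : (treesOfSize n).Nonempty := by
  refine ⟨node (List.replicate (n - 1) (node [])), ?_⟩
  simp only [treesOfSize, Set.Finite.mem_toFinset, Set.mem_ofPred_eq, size_node,
    List.map_replicate, List.sum_replicate, List.map_nil, List.sum_nil, smul_eq_mul]
  omega

theorem coe_subtrees_ne_zero (t : PlaneTree) : (t.subtrees : Multiset PlaneTree) ≠ 0 := by
  cases t with
  | node cs => simp [subtrees]

/-- A uniformly chosen random tree with `n ≥ 1` vertices. -/
noncomputable def randomTree (n : ℕ) (hn : 0 < n) : PMF PlaneTree :=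
  PMF.uniformOfFinset (treesOfSize n) (treesOfSize_nonempty n hn)

/-- The maximal subtree rooted at a uniformly chosen random vertex of `t`. -/
noncomputable def randomSubtree (t : PlaneTree) : PMF PlaneTree :=
  PMF.ofMultiset (t.subtrees : Multiset PlaneTree) t.coe_subtrees_ne_zero

/-- The law of `Y_n`, the protection number of a uniformly chosen vertex of a uniformly chosen
random tree with `n` vertices. -/
noncomputable def vertexProtectionLaw (n : ℕ) (hn : 0 < n) : PMF ℕ :=
  ((randomTree n hn).bind randomSubtree).map protection

end PlaneTree

/-! Let `V` be the series of forests, so `V = 1 + X V²`, and let `R_k` be the series of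
`k`-protected trees. A root is `(k+1)`-protected iff it has children and all of them are
`k`-protected, so `R_{k+1} = X R_k / (1 - R_k)`. This Möbius recursion has the closed solution `R_k
= (1 - X) w / (1 + w)` with `w = X^(k+1) V³`. Marking a vertex divides by `1 - X V²`. Expanding `1 /
(1 + w)` gives, for the number of pairs (tree, `k`-protected vertex), an exact alternating sum over
`j` of differences of binomial coefficients (`coeff_treeSeries_protectedCount`); the number of all
pairs is a central binomial coefficient.

Divided by the latter, the `j`-th term is `4^(-k) (-2 / 4^k)^j` times a quantity with a uniform
expansion `3 + c / n + O(s⁶ / n²)`, where `s = k (j + 1)` and `c` is quadratic in `j`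
(`abs_ballotCoeff_div_sub_le`). Summing over all `j` gives the two main terms and an error `O(k⁶ /
(4^k n²))`, stronger than required up to the bounded factor `k⁴ (3/4)^k`. -/

namespace PlaneTree

/-! ### Generating functions of trees and forests -/

open PowerSeries Finset

/-- The finite set of all forests (ordered lists of trees) with `m` vertices in total. -/
noncomputable def forestsOfSize (m : ℕ) : Finset (List PlaneTree) := (finite_forests m).toFinset

lemma mem_treesOfSize {n : ℕ} {t : PlaneTree} : t ∈ treesOfSize n ↔ t.size = n := by
  simp [treesOfSize]

lemma mem_forestsOfSize {m : ℕ} {cs : List PlaneTree} :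
    cs ∈ forestsOfSize m ↔ (cs.map size).sum = m := by
  simp [forestsOfSize]

/-- The generating function of trees, each tree `t` weighted by `f t`. -/
noncomputable def treeSeries (f : PlaneTree → ℝ) : PowerSeries ℝ :=
  PowerSeries.mk fun n => ∑ t ∈ treesOfSize n, f t

/-- The generating function of forests, each forest `cs` weighted by `g cs`. -/
noncomputable def forestSeries (g : List PlaneTree → ℝ) : PowerSeries ℝ :=
  PowerSeries.mk fun n => ∑ cs ∈ forestsOfSize n, g cs

lemma treeSeries_eq_X_mul (f : PlaneTree → ℝ) :
    treeSeries f = X * forestSeries fun cs => f (node cs) := by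
  ext n
  cases n with
  | zero =>
    simp only [treeSeries, coeff_mk, coeff_zero_X_mul]
    refine Finset.sum_eq_zero ?_
    rintro ⟨cs⟩ h
    rw [mem_treesOfSize, size_node] at h
    omega
  | succ n =>
    rw [coeff_succ_X_mul, treeSeries, forestSeries, coeff_mk, coeff_mk]
    symm
    refine Finset.sum_bij (fun cs _ => node cs) ?_ ?_ ?_ ?_
    · intro cs h
      rw [mem_forestsOfSize] at h
      rw [mem_treesOfSize, size_node, h, add_comm]
    · intro a _ b _ h
      simpa using h
    · rintro ⟨cs⟩ h
      rw [mem_treesOfSize, size_node] at h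
      exact ⟨cs, mem_forestsOfSize.2 (by omega), rfl⟩
    · simp

/-- A nonempty forest splits uniquely into its first tree and the remaining forest. -/
lemma sum_forestsOfSize (g : List PlaneTree → ℝ) (m : ℕ) :
    ∑ cs ∈ forestsOfSize m, g cs = (if m = 0 then g [] else 0) +
      ∑ p ∈ antidiagonal m, ∑ t ∈ treesOfSize p.1, ∑ r ∈ forestsOfSize p.2, g (t :: r) := by
  classical
  have hsplit : forestsOfSize m = (if m = 0 then {[]} else ∅) ∪
      (antidiagonal m).biUnion (fun p =>
        (treesOfSize p.1 ×ˢ forestsOfSize p.2).image fun q => q.1 :: q.2) := by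
    ext cs
    rw [mem_forestsOfSize]
    cases cs with
    | nil =>
      by_cases h : m = 0
      · simp [h]
      · simp [h, Ne.symm h]
    | cons t r =>
      by_cases h : m = 0
      · simp [h, mem_treesOfSize, mem_forestsOfSize]
      · simp [h, mem_treesOfSize, mem_forestsOfSize]
  rw [hsplit, Finset.sum_union, Finset.sum_biUnion]
  · congr 1
    · split_ifs <;> simp
    · refine Finset.sum_congr rfl fun p _ => ?_
      rw [Finset.sum_image, Finset.sum_product]
      rintro ⟨a, b⟩ _ ⟨c, d⟩ _ h
      simpa using h
  · rintro ⟨a, b⟩ _ ⟨c, d⟩ _ hne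
    refine Finset.disjoint_left.2 ?_
    simp only [Finset.mem_image, Finset.mem_product, mem_treesOfSize, mem_forestsOfSize]
    rintro cs ⟨⟨t, r⟩, ⟨h1, h2⟩, rfl⟩ ⟨⟨t', r'⟩, ⟨h3, h4⟩, h5⟩
    simp only [List.cons.injEq] at h5
    obtain ⟨rfl, rfl⟩ := h5
    exact hne (by simp_all)
  · refine Finset.disjoint_left.2 ?_
    intro cs h1 h2
    split_ifs at h1
    · simp only [Finset.mem_singleton] at h1
      simp [h1] at h2
    · simp at h1

lemma forestSeries_prod (f : PlaneTree → ℝ) :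
    forestSeries (fun cs => (cs.map f).prod) =
      1 + treeSeries f * forestSeries (fun cs => (cs.map f).prod) := by
  ext m
  rw [map_add, coeff_mul, forestSeries, treeSeries, coeff_mk, sum_forestsOfSize, coeff_one]
  congr 1
  refine Finset.sum_congr rfl fun p _ => ?_
  simp only [coeff_mk, List.map_cons, List.prod_cons, Finset.sum_mul_sum]

lemma forestSeries_sum (f : PlaneTree → ℝ) :
    forestSeries (fun cs => (cs.map f).sum) =
      treeSeries f * forestSeries (fun _ => 1) +
        treeSeries (fun _ => 1) * forestSeries (fun cs => (cs.map f).sum) := by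
  ext m
  rw [map_add, coeff_mul, coeff_mul, forestSeries, treeSeries, coeff_mk, sum_forestsOfSize,
    ← Finset.sum_add_distrib]
  simp only [List.map_nil, List.sum_nil, ite_self, zero_add]
  refine Finset.sum_congr rfl fun p _ => ?_
  simp only [forestSeries, treeSeries, coeff_mk, List.map_cons, List.sum_cons,
    Finset.sum_mul_sum, one_mul, mul_one, Finset.sum_add_distrib]

/-! ### Protected vertices and their functional equations -/

lemma exists_leafAtDist : ∀ t : PlaneTree, ∃ d, LeafAtDist t d
  | node [] => ⟨0, .leaf⟩
  | node (c :: cs) => by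
    obtain ⟨d, hd⟩ := exists_leafAtDist c
    exact ⟨d + 1, .child _ c d (by simp) hd⟩

lemma le_protection_iff {t : PlaneTree} {k : ℕ} :
    k ≤ t.protection ↔ ∀ d, LeafAtDist t d → k ≤ d := by
  constructor
  · intro h d hd
    exact h.trans (Nat.sInf_le hd)
  · intro h
    exact le_csInf (exists_leafAtDist t) h

lemma succ_le_protection_node {cs : List PlaneTree} {k : ℕ} :
    k + 1 ≤ (node cs).protection ↔ cs ≠ [] ∧ ∀ c ∈ cs, k ≤ c.protection := by
  simp only [le_protection_iff]
  constructor
  · intro h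
    refine ⟨?_, fun c hc d hd => ?_⟩
    · rintro rfl
      simpa using h 0 .leaf
    · simpa using h (d + 1) (.child _ c d hc hd)
  · rintro ⟨hne, h⟩ d hd
    cases hd with
    | leaf => exact absurd rfl hne
    | child _ c d hc hd => simpa using h c hc d hd

open Classical in
/-- The indicator of `k`-protected trees. -/
noncomputable def protectedWeight (k : ℕ) (t : PlaneTree) : ℝ :=
  if k ≤ t.protection then 1 else 0

/-- The number of `k`-protected vertices of a tree. -/
noncomputable def protectedCount (k : ℕ) (t : PlaneTree) : ℝ :=
  (t.subtrees.map (protectedWeight k)).sum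

lemma protectedWeight_zero : protectedWeight 0 = fun _ => 1 := by
  funext t
  simp [protectedWeight]

lemma protectedWeight_succ_node (k : ℕ) (cs : List PlaneTree) :
    protectedWeight (k + 1) (node cs) =
      -- The empty product is 1, but a leaf is not `(k+1)`-protected, hence the correction.
      (cs.map (protectedWeight k)).prod - if cs = [] then 1 else 0 := by
  have hprod : ∀ l : List PlaneTree, (l.map (protectedWeight k)).prod =
      if ∀ c ∈ l, k ≤ c.protection then 1 else 0 := by
    intro l
    induction l with
    | nil => simp
    | cons c l ih =>
      rw [List.map_cons, List.prod_cons, ih, protectedWeight]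
      by_cases h1 : k ≤ c.protection <;> simp [h1]
  rw [hprod, protectedWeight]
  simp only [succ_le_protection_node]
  by_cases h : cs = []
  · simp [h]
  · simp [h]

lemma protectedCount_node (k : ℕ) (cs : List PlaneTree) :
    protectedCount k (node cs) =
      protectedWeight k (node cs) + (cs.map (protectedCount k)).sum := by
  rw [protectedCount, subtrees, List.map_cons, List.sum_cons, List.map_flatMap]
  congr 1
  induction cs with
  | nil => simp
  | cons c cs ih => simp [ih, protectedCount]

/-- The generating function of trees. -/
noncomputable def allTrees : PowerSeries ℝ := treeSeries fun _ => 1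

/-- The generating function of forests. -/
noncomputable def allForests : PowerSeries ℝ := forestSeries fun _ => 1

lemma allTrees_eq : allTrees = X * allForests := treeSeries_eq_X_mul _

lemma allForests_eq : allForests = 1 + X * allForests ^ 2 := by
  have h := forestSeries_prod fun _ => 1
  simp only [List.map_const', List.prod_replicate, one_pow] at h
  change allForests = 1 + allTrees * allForests at h
  rw [allTrees_eq] at h
  linear_combination h

lemma treeSeries_protectedWeight_zero : treeSeries (protectedWeight 0) = allTrees := by
  rw [protectedWeight_zero, allTrees]

lemma forestSeries_nil : forestSeries (fun cs => if cs = [] then 1 else 0) = 1 := by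
  ext m
  rw [forestSeries, coeff_mk, sum_forestsOfSize, coeff_one]
  simp

lemma forestSeries_sub (f g : List PlaneTree → ℝ) :
    forestSeries (fun cs => f cs - g cs) = forestSeries f - forestSeries g := by
  ext m
  simp [forestSeries]

lemma treeSeries_protectedWeight_succ (k : ℕ) :
    treeSeries (protectedWeight (k + 1)) * (1 - treeSeries (protectedWeight k)) =
      X * treeSeries (protectedWeight k) := by
  rw [treeSeries_eq_X_mul (protectedWeight (k + 1))]
  simp only [protectedWeight_succ_node]
  rw [forestSeries_sub (fun cs => (cs.map (protectedWeight k)).prod), forestSeries_nil]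
  linear_combination (X : PowerSeries ℝ) * forestSeries_prod (protectedWeight k)

lemma forestSeries_add (f g : List PlaneTree → ℝ) :
    forestSeries (fun cs => f cs + g cs) = forestSeries f + forestSeries g := by
  ext m
  simp [forestSeries, Finset.sum_add_distrib]

/-- A protected vertex is the root or lies in one branch. In the second case the branches to its
left and right form two arbitrary forests, which gives the factor `X V²`. -/
lemma treeSeries_protectedCount (k : ℕ) :
    treeSeries (protectedCount k) * (1 - X * allForests ^ 2) =
      treeSeries (protectedWeight k) := by
  have h1 := treeSeries_eq_X_mul (protectedCount k)
  simp only [protectedCount_node] at h1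
  rw [forestSeries_add, mul_add, ← treeSeries_eq_X_mul (protectedWeight k)] at h1
  have h2 := forestSeries_sum (protectedCount k)
  change _ = _ * allForests + allTrees * _ at h2
  rw [allTrees_eq] at h2
  have h3 := allForests_eq
  set F := forestSeries fun cs => (cs.map (protectedCount k)).sum
  have h4 : F = treeSeries (protectedCount k) * allForests ^ 2 := by
    linear_combination allForests * h2 - F * h3
  rw [h4] at h1
  linear_combination h1

/-! ### The tail probability as a quotient of coefficients -/

lemma protectedCount_zero (t : PlaneTree) : protectedCount 0 t = t.size := by
  simp [protectedCount, protectedWeight_zero, size]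

open Classical in
lemma protectedCount_eq_card (k : ℕ) (t : PlaneTree) : protectedCount k t =
    ((t.subtrees : Multiset PlaneTree).filter (· ∈ {x | k ≤ x.protection})).card := by
  rw [protectedCount]
  simp only [Multiset.filter_coe, Multiset.coe_card]
  induction t.subtrees with
  | nil => simp
  | cons c l ih =>
    rw [List.map_cons, List.sum_cons, ih, List.filter_cons, protectedWeight]
    by_cases h : k ≤ c.protection
    · simp [h, add_comm]
    · simp [h]

lemma toOuterMeasure_randomSubtree (t : PlaneTree) (k : ℕ) :
    (randomSubtree t).toOuterMeasure {x | k ≤ x.protection} =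
      ENNReal.ofReal (protectedCount k t) / (t.size : ENNReal) := by
  classical
  rw [randomSubtree, PMF.toOuterMeasure_ofMultiset_apply, protectedCount_eq_card,
    ENNReal.ofReal_natCast]
  congr 1
  rw [tsum_eq_sum (s := ((t.subtrees : Multiset PlaneTree).filter
    (· ∈ {x | k ≤ x.protection})).toFinset)]
  · rw [← Nat.cast_sum]
    congr 1
    convert! Multiset.toFinset_sum_count_eq _
  · intro b hb
    rw [Multiset.mem_toFinset] at hb
    simpa using Multiset.count_eq_zero_of_notMem hb

lemma protectedCount_nonneg (k : ℕ) (t : PlaneTree) : 0 ≤ protectedCount k t := by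
  classical
  rw [protectedCount_eq_card]
  positivity

/-- The tail probability as a quotient of numbers of pairs of a tree and a vertex. -/
lemma toReal_vertexProtectionLaw (n : ℕ) (hn : 0 < n) (k : ℕ) :
    ((vertexProtectionLaw n hn).toMeasure {m : ℕ | k ≤ m}).toReal =
      coeff n (treeSeries (protectedCount k)) / coeff n (treeSeries (protectedCount 0)) := by
  have hcard : (0 : ℝ) < (treesOfSize n).card := by
    exact_mod_cast (treesOfSize_nonempty n hn).card_pos
  have hn' : (0 : ℝ) < n := by exact_mod_cast hn
  have h0 : coeff n (treeSeries (protectedCount 0)) = (treesOfSize n).card * (n : ℝ) := by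
    rw [treeSeries, coeff_mk, Finset.sum_congr rfl (g := fun _ => (n : ℝ))]
    · simp
    · intro t ht
      rw [protectedCount_zero, mem_treesOfSize.1 ht]
  rw [h0, PMF.toMeasure_apply_eq_toOuterMeasure_apply _ (MeasurableSet.of_discrete),
    vertexProtectionLaw, PMF.toOuterMeasure_map_apply, PMF.toOuterMeasure_bind_apply]
  change (∑' t, _ * (randomSubtree t).toOuterMeasure {x | k ≤ x.protection}).toReal = _
  simp only [toOuterMeasure_randomSubtree]
  rw [tsum_eq_sum (s := treesOfSize n)]
  · rw [Finset.sum_congr rfl (g := fun t => ENNReal.ofReal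
      (((treesOfSize n).card : ℝ)⁻¹ * (protectedCount k t / n)))]
    · rw [← ENNReal.ofReal_sum_of_nonneg, ENNReal.toReal_ofReal, ← Finset.mul_sum,
        ← Finset.sum_div, treeSeries, coeff_mk]
      · field_simp
      · exact Finset.sum_nonneg fun t _ => mul_nonneg (by positivity)
          (div_nonneg (protectedCount_nonneg k t) hn'.le)
      · exact fun t _ => mul_nonneg (by positivity)
          (div_nonneg (protectedCount_nonneg k t) hn'.le)
    · intro t ht
      rw [randomTree, PMF.uniformOfFinset_apply_of_mem _ ht, mem_treesOfSize.1 ht,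
        ENNReal.ofReal_mul (by positivity), ENNReal.ofReal_div_of_pos hn',
        ENNReal.ofReal_inv_of_pos hcard, ENNReal.ofReal_natCast, ENNReal.ofReal_natCast]
  · intro t ht
    rw [randomTree, PMF.uniformOfFinset_apply_of_notMem _ ht, zero_mul]
end PlaneTree

/-! ### Exact formula for the number of protected vertices -/

namespace PlaneTree
open PowerSeries Finset

/-- The generating function of the central binomial coefficients. -/
noncomputable def centralSeries : PowerSeries ℝ := (1 - 2 * X * allForests)⁻¹

lemma centralSeries_eq : centralSeries = 1 + 2 * X * allForests * centralSeries := by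
  have h : (1 - 2 * X * allForests) * centralSeries = 1 := by
    refine PowerSeries.mul_inv_cancel _ ?_
    simp
  linear_combination h

lemma choose_succ_succ_eq (l : ℕ) :
    (2 * l + 2).choose (l + 1) = 2 * (2 * l + 1).choose l := by
  rw [Nat.choose_succ_succ' (2 * l + 1) l,
    Nat.choose_symm_of_eq_add (show 2 * l + 1 = l + 1 + l by omega)]
  ring

/-- Multiplying `V = 1 + X V²` by `V^m` turns it into Pascal's rule. The case `m = 0` uses the
equation of `centralSeries` and the symmetry of binomial coefficients. -/
lemma coeff_allForests_pow_mul_centralSeries (l m : ℕ) :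
    coeff l (allForests ^ m * centralSeries) = ((2 * l + m).choose l : ℝ) := by
  have hrec (m : ℕ) : allForests ^ (m + 1) * centralSeries =
      allForests ^ m * centralSeries + X * (allForests ^ (m + 2) * centralSeries) := by
    linear_combination (allForests ^ m * centralSeries) * allForests_eq
  induction l generalizing m with
  | zero =>
    have h1 : constantCoeff allForests = 1 := by
      rw [allForests_eq]
      simp
    have h2 : constantCoeff centralSeries = 1 := by
      rw [centralSeries_eq]
      simp
    simp [h1, h2]
  | succ l ih =>
    induction m with
    | zero =>
      have h : allForests ^ 0 * centralSeries =
          1 + X * (allForests ^ 1 * centralSeries + allForests ^ 1 * centralSeries) := by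
        linear_combination centralSeries_eq
      rw [h, map_add, coeff_succ_X_mul, map_add, ih, coeff_one, if_neg (by omega)]
      have := choose_succ_succ_eq l
      rw [show 2 * (l + 1) + 0 = 2 * l + 2 by ring, this]
      push_cast
      ring
    | succ m ihm =>
      rw [hrec, map_add, coeff_succ_X_mul, ih, ihm,
        show 2 * (l + 1) + (m + 1) = (2 * l + (m + 2)) + 1 by ring,
        Nat.choose_succ_succ', show 2 * (l + 1) + m = 2 * l + (m + 2) by ring]
      push_cast
      ring

lemma isUnit_one_add_X_mul (f : PowerSeries ℝ) : IsUnit (1 + X * f) := by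
  rw [PowerSeries.isUnit_iff_constantCoeff]
  simp

/-- The map `R ↦ X R / (1 - R)` has fixed points `0` and `1 - X`, and it multiplies `R / (1 - X -
R)` by `X`. For `k = 0` this quotient is `X V³`. -/
lemma treeSeries_protectedWeight_mul (k : ℕ) :
    treeSeries (protectedWeight k) * (1 + X ^ (k + 1) * allForests ^ 3) =
      X ^ (k + 1) * allForests ^ 3 * (1 - X) := by
  induction k with
  | zero =>
    rw [treeSeries_protectedWeight_zero, allTrees_eq]
    linear_combination (-(X : PowerSeries ℝ) * allForests * (1 + allForests)) * allForests_eq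
  | succ k ih =>
    set w : PowerSeries ℝ := X ^ (k + 1) * allForests ^ 3 with hw
    set R := treeSeries (protectedWeight k)
    have hw' : (X : PowerSeries ℝ) ^ (k + 1 + 1) * allForests ^ 3 = X * w := by
      rw [hw]
      ring
    have hunit : IsUnit (1 + w) := by
      rw [hw, pow_succ', mul_assoc]
      exact isUnit_one_add_X_mul _
    rw [hw']
    have h := treeSeries_protectedWeight_succ k
    refine hunit.mul_left_cancel ?_
    have h1 : (1 - R) * (1 + w) = 1 + w * X := by linear_combination -ih
    linear_combination (1 + w) * ((1 + w) * h + X * ih)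
      - treeSeries (protectedWeight (k + 1)) * (1 + w) * h1

lemma treeSeries_protectedCount_mul (k : ℕ) :
    treeSeries (protectedCount k) * (1 + X ^ (k + 1) * allForests ^ 3) =
      (1 - X) * (X ^ (k + 1) * (allForests ^ 2 * centralSeries)) := by
  have h1 := treeSeries_protectedCount k
  have h2 := treeSeries_protectedWeight_mul k
  have h3 := allForests_eq
  have h4 := centralSeries_eq
  have hV : IsUnit allForests := by
    rw [h3]
    exact isUnit_one_add_X_mul _
  refine hV.mul_left_cancel ?_
  -- Thus `1 / (1 - X V²)` is `centralSeries / V`.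
  have h5 : (1 - X * allForests ^ 2) * centralSeries = allForests := by
    linear_combination allForests * h4 - centralSeries * h3
  set S := treeSeries (protectedCount k)
  set w : PowerSeries ℝ := X ^ (k + 1) with hw
  linear_combination centralSeries * (1 + w * allForests ^ 3) * h1 + centralSeries * h2
    - S * (1 + w * allForests ^ 3) * h5

/-- The coefficient of `X ^ n` in `(1 - X) X ^ a (1 - T)⁻ᵐ (1 - 4 X) ^ (-1/2)`, where `T` is the
generating function of plane trees. -/
noncomputable def ballotCoeff (n a m : ℕ) : ℝ :=
  coeff n ((1 - X) * (X ^ a * (allForests ^ m * centralSeries)))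

lemma ballotCoeff_of_lt {n a : ℕ} (h : n < a) (m : ℕ) : ballotCoeff n a m = 0 := by
  rw [ballotCoeff, mul_left_comm, coeff_X_pow_mul', if_neg (by omega)]

lemma ballotCoeff_add (l a m : ℕ) : ballotCoeff (l + a) a m =
    ((2 * l + m).choose l : ℝ) - if l = 0 then 0 else ((2 * (l - 1) + m).choose (l - 1) : ℝ) := by
  rw [ballotCoeff, mul_left_comm, coeff_X_pow_mul, sub_mul, one_mul, map_sub,
    coeff_allForests_pow_mul_centralSeries]
  cases l with
  | zero => simp
  | succ l => rw [coeff_succ_X_mul, coeff_allForests_pow_mul_centralSeries]; simp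

lemma coeff_treeSeries_protectedCount (n k : ℕ) :
    coeff n (treeSeries (protectedCount k)) =
      ∑ j ∈ range n, (-1) ^ j * ballotCoeff n ((k + 1) * (j + 1)) (3 * j + 2) := by
  have h := treeSeries_protectedCount_mul k
  set S := treeSeries (protectedCount k)
  have key (M : ℕ) : S = (∑ j ∈ range M, (-1) ^ j * ((1 - X) * (X ^ ((k + 1) * (j + 1)) *
      (allForests ^ (3 * j + 2) * centralSeries)))) +
      (X : PowerSeries ℝ) ^ M * (X ^ (k * M) * ((-1) ^ M * allForests ^ (3 * M) * S)) := by
    induction M with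
    | zero => simp
    | succ M ih =>
      rw [Finset.sum_range_succ]
      refine ih.trans ?_
      rw [add_assoc]
      congr 1
      linear_combination (X : PowerSeries ℝ) ^ (M + k * M) * (-1) ^ M * allForests ^ (3 * M) * h
  -- With `n + 1` terms the remainder is divisible by `X^(n+1)`; the last term then vanishes too, as
  -- `(k + 1)(n + 1) > n`.
  have h4 := congrArg (coeff n) (key (n + 1))
  rw [map_add, coeff_X_pow_mul', if_neg (by omega), add_zero, map_sum,
    Finset.sum_range_succ] at h4
  rw [h4]
  have hz (j : ℕ) : coeff n ((-1) ^ j * ((1 - X) * (X ^ ((k + 1) * (j + 1)) *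
      (allForests ^ (3 * j + 2) * centralSeries)))) =
      (-1) ^ j * ballotCoeff n ((k + 1) * (j + 1)) (3 * j + 2) := by
    rw [ballotCoeff, show ((-1 : PowerSeries ℝ)) ^ j = C ((-1 : ℝ) ^ j) by simp, coeff_C_mul]
  simp only [hz]
  rw [ballotCoeff_of_lt (by nlinarith), mul_zero, add_zero]

lemma coeff_treeSeries_protectedCount_zero (n : ℕ) :
    coeff (n + 1) (treeSeries (protectedCount 0)) = (n.centralBinom : ℝ) := by
  have h1 := treeSeries_protectedCount 0
  rw [treeSeries_protectedWeight_zero, allTrees_eq] at h1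
  have h3 := allForests_eq
  have h4 := centralSeries_eq
  have h : treeSeries (protectedCount 0) = X * (allForests ^ 0 * centralSeries) := by
    have hV : IsUnit allForests := by
      rw [h3]
      exact isUnit_one_add_X_mul _
    refine hV.mul_left_cancel ?_
    have h5 : (1 - X * allForests ^ 2) * centralSeries = allForests := by
      linear_combination allForests * h4 - centralSeries * h3
    linear_combination centralSeries * h1 - treeSeries (protectedCount 0) * h5
  rw [h, coeff_succ_X_mul, coeff_allForests_pow_mul_centralSeries, add_zero,
    Nat.centralBinom_eq_two_mul_choose]
end PlaneTree

/-! ### Factorials and binomial coefficients near the centre -/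

lemma abs_log_one_sub_add_le {x : ℝ} (hx : |x| ≤ 1 / 2) : |Real.log (1 - x) + x| ≤ 2 * x ^ 2 := by
  have h := Real.abs_log_sub_add_sum_range_le (lt_of_le_of_lt hx (by norm_num)) 1
  simp only [Finset.sum_range_one, zero_add, pow_one, Nat.cast_zero, div_one] at h
  rw [add_comm] at h
  refine h.trans ?_
  rw [show 1 + 1 = 2 from rfl, sq_abs, div_le_iff₀ (by linarith)]
  nlinarith [sq_nonneg x]

open Nat in
-- The logarithm is a sum of `log (N + i)` for `i ≤ d`; each summand is linearised at `N` with error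
-- at most `2 i² / N²`.
lemma abs_log_factorial_add_sub_le {N : ℕ} (hN : 0 < N) (d : ℕ) (hd : 2 * d ≤ N) :
    |Real.log ((N + d)! : ℝ) - Real.log (N ! : ℝ) -
      (d * Real.log N + ((d : ℝ) ^ 2 + d) / (2 * N))| ≤ 2 * (d : ℝ) ^ 3 / (N : ℝ) ^ 2 := by
  have hN' : (0 : ℝ) < N := by exact_mod_cast hN
  induction d with
  | zero => simp
  | succ d ih =>
    have ih := ih (by omega)
    have hd' : 2 * ((d : ℝ) + 1) ≤ N := by exact_mod_cast hd
    have hx : |-(((d : ℝ) + 1) / N)| ≤ 1 / 2 := by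
      rw [abs_neg, abs_of_nonneg (by positivity), div_le_iff₀ hN']
      linarith
    have h1 := abs_log_one_sub_add_le hx
    have h2 : Real.log ((N + (d + 1))! : ℝ) =
        Real.log N + Real.log (1 - -(((d : ℝ) + 1) / N)) + Real.log ((N + d)! : ℝ) := by
      have h3 : 0 ≤ ((d : ℝ) + 1) / N := by positivity
      have h4 : ((N + d + 1 : ℕ) : ℝ) = N * (1 - -(((d : ℝ) + 1) / N)) := by
        push_cast
        field_simp
        ring
      rw [← add_assoc, Nat.factorial_succ, Nat.cast_mul, h4, Real.log_mul
        (mul_pos hN' (by linarith)).ne' (by positivity), Real.log_mul hN'.ne' (by linarith)]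
    have e : Real.log ((N + (d + 1))! : ℝ) - Real.log (N ! : ℝ) -
        (((d + 1 : ℕ) : ℝ) * Real.log N + (((d + 1 : ℕ) : ℝ) ^ 2 + (d + 1 : ℕ)) / (2 * N)) =
        (Real.log ((N + d)! : ℝ) - Real.log (N ! : ℝ) -
          (d * Real.log N + ((d : ℝ) ^ 2 + d) / (2 * N))) +
        (Real.log (1 - -(((d : ℝ) + 1) / N)) + -(((d : ℝ) + 1) / N)) := by
      rw [h2]
      push_cast
      field_simp
      ring
    rw [e]
    refine (abs_add_le _ _).trans ((add_le_add ih h1).trans ?_)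
    rw [neg_sq, div_pow, mul_div_assoc', ← add_div, div_le_div_iff_of_pos_right (by positivity)]
    push_cast
    nlinarith [(Nat.cast_nonneg d : (0 : ℝ) ≤ d)]

open Nat in
lemma abs_log_factorial_sub_sub_le {N : ℕ} (hN : 0 < N) (d M : ℕ) (hd : 2 * d ≤ N)
    (hM : M + d = N) :
    |Real.log (M ! : ℝ) - Real.log (N ! : ℝ) -
      (-d * Real.log N + ((d : ℝ) ^ 2 - d) / (2 * N))| ≤ 2 * (d : ℝ) ^ 3 / (N : ℝ) ^ 2 := by
  have hN' : (0 : ℝ) < N := by exact_mod_cast hN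
  induction d generalizing M with
  | zero => simp [← hM]
  | succ d ih =>
    have ih := ih (M + 1) (by omega) (by omega)
    have hd' : 2 * ((d : ℝ) + 1) ≤ N := by exact_mod_cast hd
    have hx : |(d : ℝ) / N| ≤ 1 / 2 := by
      rw [abs_of_nonneg (by positivity), div_le_iff₀ hN']
      linarith
    have h1 := abs_log_one_sub_add_le hx
    have hMr : (M : ℝ) + (d + 1) = N := by exact_mod_cast hM
    have h2 : Real.log ((M + 1)! : ℝ) =
        Real.log N + Real.log (1 - (d : ℝ) / N) + Real.log (M ! : ℝ) := by
      have h3 := (abs_le.1 hx).2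
      have h4 : ((M + 1 : ℕ) : ℝ) = N * (1 - (d : ℝ) / N) := by
        push_cast
        field_simp
        linarith
      rw [Nat.factorial_succ, Nat.cast_mul, h4, Real.log_mul
        (mul_pos hN' (by linarith)).ne' (by positivity), Real.log_mul hN'.ne' (by linarith)]
    have e : Real.log (M ! : ℝ) - Real.log (N ! : ℝ) -
        (-((d + 1 : ℕ) : ℝ) * Real.log N + (((d + 1 : ℕ) : ℝ) ^ 2 - (d + 1 : ℕ)) / (2 * N)) =
        (Real.log ((M + 1)! : ℝ) - Real.log (N ! : ℝ) -
          (-d * Real.log N + ((d : ℝ) ^ 2 - d) / (2 * N))) +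
        -(Real.log (1 - (d : ℝ) / N) + (d : ℝ) / N) := by
      rw [h2]
      push_cast
      field_simp
      ring
    rw [e]
    rw [← abs_neg] at h1
    refine (abs_add_le _ _).trans ((add_le_add ih h1).trans ?_)
    rw [div_pow, mul_div_assoc', ← add_div, div_le_div_iff_of_pos_right (by positivity)]
    push_cast
    nlinarith [(Nat.cast_nonneg d : (0 : ℝ) ≤ d)]

open Nat in
/-- Second order expansion of `log M!` around `N`. -/
lemma abs_log_factorial_sub_le {N : ℕ} (hN : 0 < N) (M : ℕ) {D : ℝ}
    (h1 : |(M : ℝ) - N| ≤ D) (h2 : 2 * D ≤ N) :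
    |Real.log (M ! : ℝ) - Real.log (N ! : ℝ) -
      (((M : ℝ) - N) * Real.log N + (((M : ℝ) - N) ^ 2 + ((M : ℝ) - N)) / (2 * N))| ≤
      2 * D ^ 3 / (N : ℝ) ^ 2 := by
  rcases le_total N M with h | h
  · obtain ⟨d, rfl⟩ := Nat.exists_eq_add_of_le h
    have e : ((N + d : ℕ) : ℝ) - N = d := by push_cast; ring
    rw [e] at h1 ⊢
    rw [abs_of_nonneg (Nat.cast_nonneg d)] at h1
    refine (abs_log_factorial_add_sub_le hN d ?_).trans (by gcongr)
    have : 2 * (d : ℝ) ≤ N := by linarith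
    exact_mod_cast this
  · obtain ⟨d, hd⟩ := Nat.exists_eq_add_of_le h
    have e : (M : ℝ) - N = -d := by rw [hd]; push_cast; ring
    rw [e] at h1 ⊢
    rw [abs_neg, abs_of_nonneg (Nat.cast_nonneg d)] at h1
    rw [neg_sq, ← sub_eq_add_neg]
    refine (abs_log_factorial_sub_sub_le hN d M ?_ hd.symm).trans (by gcongr)
    have : 2 * (d : ℝ) ≤ N := by linarith
    exact_mod_cast this

open Nat in
lemma log_choose_add (a b : ℕ) : Real.log ((a + b).choose a : ℝ) =
    Real.log ((a + b)! : ℝ) - Real.log (a ! : ℝ) - Real.log (b ! : ℝ) := by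
  have h : (((a + b).choose a : ℕ) : ℝ) * a ! * b ! = (a + b)! := by
    have := Nat.choose_mul_factorial_mul_factorial (Nat.le_add_right a b)
    rw [Nat.add_sub_cancel_left] at this
    exact_mod_cast this
  have h0 : (0 : ℝ) < (a + b).choose a := by
    exact_mod_cast Nat.choose_pos (Nat.le_add_right a b)
  rw [← h, Real.log_mul (by positivity) (by positivity), Real.log_mul (by positivity)
    (by positivity)]
  ring

/-- In the expansions of `(a + b)!`, `a!` and `b!` the multiples of `log N` cancel since the
displacements of `a` and `b` add up to `-r`; the factor `2^r` cancels the remaining `log 2`. The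
errors are `2 + 2 + 4` times `D³ / N²`. -/
lemma abs_log_choose_div_centralBinom_sub_le {N a b r : ℕ} (hN : 0 < N)
    (hr : a + b + r = 2 * N) {D : ℝ} (ha : |(a : ℝ) - N| ≤ D) (hb : |(b : ℝ) - N| ≤ D)
    (hDN : 2 * D ≤ N) :
    |Real.log (2 ^ r * ((a + b).choose a : ℝ) / N.centralBinom) -
      (r - ((a : ℝ) - b) ^ 2) / 4 / N| ≤ 8 * D ^ 3 / (N : ℝ) ^ 2 := by
  have hN' : (0 : ℝ) < N := by exact_mod_cast hN
  have h1 := abs_log_factorial_sub_le hN a ha hDN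
  have h2 := abs_log_factorial_sub_le hN b hb hDN
  have hrr : (a : ℝ) + b + r = 2 * N := by exact_mod_cast hr
  have h3 : |((a + b : ℕ) : ℝ) - (2 * N : ℕ)| ≤ 2 * D := by
    push_cast
    rw [abs_le] at *
    constructor <;> linarith [ha.1, ha.2, hb.1, hb.2]
  have h4 := abs_log_factorial_sub_le (by omega : 0 < 2 * N) (a + b) h3
    (by push_cast; linarith)
  have hC : (0 : ℝ) < (a + b).choose a := by
    exact_mod_cast Nat.choose_pos (Nat.le_add_right a b)
  have hB : (0 : ℝ) < N.centralBinom := by exact_mod_cast Nat.centralBinom_pos N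
  have e1 : Real.log (2 ^ r * ((a + b).choose a : ℝ) / N.centralBinom) = r * Real.log 2 + Real.log ((a + b).choose a : ℝ) -
      Real.log ((N + N).choose N : ℝ) := by
    rw [Real.log_div (by positivity) (by positivity), Real.log_mul (by positivity)
      (by positivity), Real.log_pow, Nat.centralBinom_eq_two_mul_choose, two_mul]
  rw [log_choose_add, log_choose_add, ← two_mul] at e1
  have e2 : Real.log ((2 * N : ℕ) : ℝ) = Real.log 2 + Real.log N := by
    push_cast
    rw [Real.log_mul (by norm_num) (by positivity)]
  rw [e2] at h4
  have e3 : ((a + b : ℕ) : ℝ) - (2 * N : ℕ) = -r := by push_cast; linarith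
  rw [e3] at h4
  have e4 : (a : ℝ) = 2 * N - r - b := by linarith
  rw [abs_le] at h1 h2 h4 ⊢
  have e5 : (r - ((a : ℝ) - b) ^ 2) / 4 / (N : ℝ) = ((-(r : ℝ)) ^ 2 + -r) / (2 * (2 * N : ℕ)) -
      (((a : ℝ) - N) ^ 2 + ((a : ℝ) - N)) / (2 * N) -
      (((b : ℝ) - N) ^ 2 + ((b : ℝ) - N)) / (2 * N) := by
    rw [e4]
    push_cast
    field_simp
    ring
  have e6 : ((a : ℝ) - N) * Real.log N + ((b : ℝ) - N) * Real.log N = -r * Real.log N := by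
    rw [e4]
    ring
  have e7 : 2 * (2 * D) ^ 3 / ((2 * N : ℕ) : ℝ) ^ 2 = 4 * (D ^ 3 / (N : ℝ) ^ 2) := by
    push_cast
    field_simp
    ring
  rw [e7] at h4
  rw [mul_div_assoc] at h1 h2 ⊢
  rw [e5, e1]
  constructor <;> linarith [h1.1, h1.2, h2.1, h2.2, h4.1, h4.2]

/-- Binomial coefficients near the central one, up to a relative error of second order. -/
lemma abs_choose_div_centralBinom_sub_le {N a b r : ℕ} (hr : a + b + r = 2 * N) {D : ℝ}
    (hD : 1 ≤ D) (ha : |(a : ℝ) - N| ≤ D) (hb : |(b : ℝ) - N| ≤ D) (hDN : 16 * D ^ 2 ≤ N) :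
    |2 ^ r * ((a + b).choose a : ℝ) / N.centralBinom -
      (1 + (r - ((a : ℝ) - b) ^ 2) / 4 / (N + 1))| ≤ 72 * D ^ 4 / ((N : ℝ) + 1) ^ 2 := by
  have hN' : (0 : ℝ) < N := by nlinarith
  have hN : 0 < N := by exact_mod_cast hN'
  have hN1 : (1 : ℝ) ≤ N := by exact_mod_cast hN
  have hrr : (a : ℝ) + b + r = 2 * N := by exact_mod_cast hr
  set γ : ℝ := (r - ((a : ℝ) - b) ^ 2) / 4 with hγ
  have hC : (0 : ℝ) < (a + b).choose a := by
    exact_mod_cast Nat.choose_pos (Nat.le_add_right a b)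
  have hB : (0 : ℝ) < N.centralBinom := by exact_mod_cast Nat.centralBinom_pos N
  set δ : ℝ := Real.log (2 ^ r * ((a + b).choose a : ℝ) / N.centralBinom) with hδ
  have hexp : 2 ^ r * ((a + b).choose a : ℝ) / N.centralBinom = Real.exp δ := by
    rw [hδ, Real.exp_log (by positivity)]
  have hδ' : |δ - γ / N| ≤ 8 * D ^ 3 / (N : ℝ) ^ 2 :=
    abs_log_choose_div_centralBinom_sub_le hN hr ha hb (by nlinarith)
  have hγ' : |γ| ≤ 2 * D ^ 2 := by
    rw [abs_le] at ha hb
    have h5 : ((a : ℝ) - b) ^ 2 ≤ (2 * D) ^ 2 := by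
      refine sq_le_sq' ?_ ?_ <;> linarith [ha.1, ha.2, hb.1, hb.2]
    have h6 : D ≤ D ^ 2 := le_self_pow₀ hD (by norm_num)
    have h7 := sq_nonneg ((a : ℝ) - b)
    rw [hγ, abs_le]
    constructor <;> linarith [ha.1, ha.2, hb.1, hb.2]
  have hγN : |γ / N| ≤ 2 * D ^ 2 / N := by
    rw [abs_div, abs_of_pos hN']
    gcongr
  have hδabs : |δ| ≤ 3 * D ^ 2 / N := by
    have h5 : |δ| ≤ |δ - γ / N| + |γ / N| := by
      simpa using abs_add_le (δ - γ / N) (γ / N)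
    have h6 : 8 * D ^ 3 / (N : ℝ) ^ 2 ≤ D ^ 2 / N := by
      rw [div_le_div_iff₀ (by positivity) hN']
      have : 8 * D ≤ N := by nlinarith
      calc 8 * D ^ 3 * N = (D ^ 2 * N) * (8 * D) := by ring
        _ ≤ (D ^ 2 * N) * N := by gcongr
        _ = _ := by ring
    calc |δ| ≤ D ^ 2 / N + 2 * D ^ 2 / N := by linarith
      _ = _ := by ring
  -- The condition `16 D² ≤ N` keeps the logarithm small enough for the quadratic bound on `exp`.
  have hδ1 : |δ| ≤ 1 := by
    refine hδabs.trans ?_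
    rw [div_le_one hN']
    nlinarith
  have h5 := Real.abs_exp_sub_one_sub_id_le hδ1
  have h6 : δ ^ 2 ≤ 9 * D ^ 4 / (N : ℝ) ^ 2 := by
    rw [← sq_abs]
    calc |δ| ^ 2 ≤ (3 * D ^ 2 / N) ^ 2 := by gcongr
      _ = _ := by ring
  have h7 : |γ / N - γ / (N + 1)| ≤ 4 * D ^ 4 / ((N : ℝ) + 1) ^ 2 := by
    have e : γ / N - γ / (N + 1) = γ / (N * (N + 1)) := by
      field_simp
      ring
    rw [e, abs_div, abs_of_pos (by positivity : (0 : ℝ) < N * (N + 1)),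
      div_le_div_iff₀ (by positivity) (by positivity)]
    calc |γ| * ((N : ℝ) + 1) ^ 2 ≤ (2 * D ^ 2) * ((N + 1) * (2 * N)) := by
          rw [pow_two ((N : ℝ) + 1)]
          gcongr
          linarith
      _ = 4 * D ^ 2 * (N * (N + 1)) := by ring
      _ ≤ 4 * D ^ 4 * (N * (N + 1)) := by
          gcongr 4 * ?_ * _
          exact pow_le_pow_right₀ hD (by norm_num)
  have h8 : 8 * D ^ 3 / (N : ℝ) ^ 2 + 9 * D ^ 4 / (N : ℝ) ^ 2 ≤
      68 * D ^ 4 / ((N : ℝ) + 1) ^ 2 := by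
    rw [← add_div, div_le_div_iff₀ (by positivity) (by positivity)]
    have : D ^ 3 ≤ D ^ 4 := pow_le_pow_right₀ hD (by norm_num)
    calc (8 * D ^ 3 + 9 * D ^ 4) * ((N : ℝ) + 1) ^ 2 ≤ (17 * D ^ 4) * (2 * N) ^ 2 := by
          gcongr <;> linarith
      _ = _ := by ring
  rw [hexp]
  calc |Real.exp δ - (1 + γ / (N + 1))| =
        |(Real.exp δ - 1 - δ) + (δ - γ / N) + (γ / N - γ / (N + 1))| := by ring_nf
    _ ≤ |Real.exp δ - 1 - δ| + |δ - γ / N| + |γ / N - γ / (N + 1)| := abs_add_three _ _ _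
    _ ≤ 68 * D ^ 4 / ((N : ℝ) + 1) ^ 2 + 4 * D ^ 4 / ((N : ℝ) + 1) ^ 2 := by linarith
    _ = _ := by ring

/-! ### Uniform expansion of one summand -/

namespace PlaneTree
open Finset

/-- Two applications of Pascal's rule turn the difference into a positive sum of three binomials
with the same upper index, to each of which the central expansion applies. -/
lemma ballotCoeff_eq_sum (l a j : ℕ) : ballotCoeff (l + 2 + a) a (3 * j + 2) =
    ((l + 2 + (l + 2 + 3 * j)).choose (l + 2) : ℝ) + ((l + 1 + (l + 3 + 3 * j)).choose (l + 1) : ℝ)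
      + ((l + (l + 4 + 3 * j)).choose l : ℝ) := by
  rw [ballotCoeff_add, if_neg (by omega)]
  have h1 : (2 * (l + 2) + (3 * j + 2)).choose (l + 2) =
      (2 * l + 3 * j + 4).choose l + 2 * (2 * l + 3 * j + 4).choose (l + 1) +
        (2 * l + 3 * j + 4).choose (l + 2) := by
    rw [show 2 * (l + 2) + (3 * j + 2) = 2 * l + 3 * j + 4 + 1 + 1 by ring,
      Nat.choose_succ_succ', Nat.choose_succ_succ', Nat.choose_succ_succ' _ (l + 1)]
    ring
  rw [h1, show l + 2 + (l + 2 + 3 * j) = 2 * l + 3 * j + 4 by ring,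
    show l + 1 + (l + 3 + 3 * j) = 2 * l + 3 * j + 4 by ring,
    show l + (l + 4 + 3 * j) = 2 * l + 3 * j + 4 by ring,
    show 2 * (l + 2 - 1) + (3 * j + 2) = 2 * l + 3 * j + 4 by omega,
    show l + 2 - 1 = l + 1 by omega]
  push_cast
  ring

lemma abs_ballotCoeff_add_le (l a m : ℕ) : |ballotCoeff (l + a) a m| ≤ 2 ^ (2 * l + m) := by
  rw [ballotCoeff_add]
  have h1 : ((2 * l + m).choose l : ℝ) ≤ 2 ^ (2 * l + m) := by
    exact_mod_cast Nat.choose_le_two_pow _ _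
  have h2 : ((2 * (l - 1) + m).choose (l - 1) : ℝ) ≤ 2 ^ (2 * l + m) := by
    have := (Nat.choose_le_two_pow (2 * (l - 1) + m) (l - 1)).trans
      (Nat.pow_le_pow_right (by norm_num) (show 2 * (l - 1) + m ≤ 2 * l + m by omega))
    exact_mod_cast this
  have h3 : (0 : ℝ) ≤ (2 * l + m).choose l := by positivity
  have h4 : (0 : ℝ) ≤ (2 * (l - 1) + m).choose (l - 1) := by positivity
  rw [abs_le]
  split_ifs <;> constructor <;> linarith

/-- A crude bound for the range where `N` is small compared with `s²`; it rests on `4^N ≤ (2 N + 1)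
centralBinom N`. -/
lemma abs_ballotCoeff_div_le {N s j r : ℕ} (hr : r + j = 2 * s) :
    |2 ^ r * ballotCoeff (N + 1) (s + j + 1) (3 * j + 2) / N.centralBinom| ≤ 8 * (N + 1) := by
  have hB : (0 : ℝ) < N.centralBinom := by exact_mod_cast Nat.centralBinom_pos N
  rcases lt_or_ge (N + 1) (s + j + 1) with h | h
  · rw [ballotCoeff_of_lt h, mul_zero, zero_div, abs_zero]
    positivity
  · obtain ⟨l, hl⟩ := Nat.exists_eq_add_of_le' h
    rw [hl, abs_div, abs_mul, abs_of_pos hB, abs_of_pos (by positivity : (0 : ℝ) < 2 ^ r),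
      div_le_iff₀ hB]
    have h1 := abs_ballotCoeff_add_le l (s + j + 1) (3 * j + 2)
    have h2 : (4 : ℝ) ^ N ≤ (2 * N + 1) * N.centralBinom := by
      rw [Nat.centralBinom_eq_two_mul_choose]
      exact_mod_cast Nat.four_pow_le_two_mul_add_one_mul_central_binom N
    calc (2 : ℝ) ^ r * |ballotCoeff (l + (s + j + 1)) (s + j + 1) (3 * j + 2)|
        ≤ 2 ^ r * 2 ^ (2 * l + (3 * j + 2)) := by gcongr
      _ = 4 * 4 ^ N := by
        rw [← pow_add, show r + (2 * l + (3 * j + 2)) = 2 + 2 * N by omega, pow_add, pow_mul]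
        norm_num
      _ ≤ 4 * ((2 * N + 1) * N.centralBinom) := by gcongr
      _ ≤ 8 * (N + 1) * N.centralBinom := by nlinarith

lemma abs_ballotCoeff_div_sub_le_of_le {N s j r : ℕ} (hs : j + 1 ≤ s) (hr : r + j = 2 * s)
    (hN : 256 * s ^ 2 ≤ N) :
    |2 ^ r * ballotCoeff (N + 1) (s + j + 1) (3 * j + 2) / N.centralBinom -
      (3 + (6 * s - 27 * (j : ℝ) ^ 2 - 39 * j - 20) / 4 / (N + 1))| ≤
      3 * (72 * (4 * (s : ℝ)) ^ 4 / ((N : ℝ) + 1) ^ 2) := by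
  have hlow : s + j + 2 ≤ N := by nlinarith
  obtain ⟨l, hl⟩ := Nat.exists_eq_add_of_le' hlow
  have hNr : (N : ℝ) = l + (s + j + 2) := by exact_mod_cast hl
  have hsr : (j : ℝ) + 1 ≤ s := by exact_mod_cast hs
  have hrr : (r : ℝ) + j = 2 * s := by exact_mod_cast hr
  have hj0 : (0 : ℝ) ≤ j := by positivity
  have hD : 1 ≤ 4 * (s : ℝ) := by linarith
  have hDN : 16 * (4 * (s : ℝ)) ^ 2 ≤ N := by
    have : 256 * (s : ℝ) ^ 2 ≤ N := by exact_mod_cast hN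
    linarith
  -- Here `D = 4 s`, so `16 D² = 256 s²`. The three binomials have `b - a = 3 j + 2 i'` with `i' =
  -- 0, 1, 2`; the squares sum to `27 j² + 36 j + 20`, and `3 r = 6 s - 3 j`.
  have key (i i' : ℕ) (hi : i + i' = 2) := abs_choose_div_centralBinom_sub_le (N := N)
    (a := l + i) (b := l + 2 + i' + 3 * j) (r := r) (by omega) hD
    (by
      have : (i : ℝ) + i' = 2 := by exact_mod_cast hi
      have : (0 : ℝ) ≤ i := by positivity
      have : (0 : ℝ) ≤ i' := by positivity
      push_cast
      rw [abs_le]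
      constructor <;> linarith)
    (by
      have : (i : ℝ) + i' = 2 := by exact_mod_cast hi
      have : (0 : ℝ) ≤ i := by positivity
      have : (0 : ℝ) ≤ i' := by positivity
      push_cast
      rw [abs_le]
      constructor <;> linarith) hDN
  have h0 := key 2 0 rfl
  have h1 := key 1 1 rfl
  have h2 := key 0 2 rfl
  have hb : ballotCoeff (N + 1) (s + j + 1) (3 * j + 2) =
      ((l + 2 + (l + 2 + 0 + 3 * j)).choose (l + 2) : ℝ) +
      ((l + 1 + (l + 2 + 1 + 3 * j)).choose (l + 1) : ℝ) +
      ((l + 0 + (l + 2 + 2 + 3 * j)).choose (l + 0) : ℝ) := by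
    rw [show N + 1 = l + 2 + (s + j + 1) by omega, ballotCoeff_eq_sum,
      show l + 3 = l + 2 + 1 from rfl, show l + 4 = l + 2 + 2 from rfl]
    simp only [add_zero]
  have hγ : (6 * s - 27 * (j : ℝ) ^ 2 - 39 * j - 20) / 4 / ((N : ℝ) + 1) =
      (r - (((l + 2 : ℕ) : ℝ) - (l + 2 + 0 + 3 * j : ℕ)) ^ 2) / 4 / (N + 1) +
      (r - (((l + 1 : ℕ) : ℝ) - (l + 2 + 1 + 3 * j : ℕ)) ^ 2) / 4 / (N + 1) +
      (r - (((l + 0 : ℕ) : ℝ) - (l + 2 + 2 + 3 * j : ℕ)) ^ 2) / 4 / (N + 1) := by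
    rw [show (r : ℝ) = 2 * s - j by linarith]
    push_cast
    ring
  rw [hb, hγ, mul_add, mul_add, add_div, add_div]
  rw [abs_le] at h0 h1 h2 ⊢
  constructor <;> linarith [h0.1, h0.2, h1.1, h1.2, h2.1, h2.2]

/-- A uniform expansion of the summands of the exact formula. -/
lemma abs_ballotCoeff_div_sub_le {N s j r : ℕ} (hs : j + 1 ≤ s) (hr : r + j = 2 * s) :
    |2 ^ r * ballotCoeff (N + 1) (s + j + 1) (3 * j + 2) / N.centralBinom -
      (3 + (6 * s - 27 * (j : ℝ) ^ 2 - 39 * j - 20) / 4 / (N + 1))| ≤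
      200000000 * (s : ℝ) ^ 6 / ((N : ℝ) + 1) ^ 2 := by
  have hsr : (j : ℝ) + 1 ≤ s := by exact_mod_cast hs
  have hj0 : (0 : ℝ) ≤ j := by positivity
  have hs1 : (1 : ℝ) ≤ s := by linarith
  rcases le_or_gt (256 * s ^ 2) N with h | h
  · refine (abs_ballotCoeff_div_sub_le_of_le hs hr h).trans ?_
    rw [mul_div_assoc']
    gcongr ?_ / _
    have : (s : ℝ) ^ 4 ≤ (s : ℝ) ^ 6 := pow_le_pow_right₀ hs1 (by norm_num)
    have : 0 ≤ (s : ℝ) ^ 6 := by positivity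
    linarith
  · have h1 := abs_ballotCoeff_div_le (N := N) hr
    have hN : (N : ℝ) + 1 ≤ 256 * (s : ℝ) ^ 2 := by exact_mod_cast h
    have h2 : |(6 * s - 27 * (j : ℝ) ^ 2 - 39 * j - 20) / 4 / ((N : ℝ) + 1)| ≤
        23 * (s : ℝ) ^ 2 := by
      rw [abs_div, abs_of_pos (by positivity : (0 : ℝ) < N + 1)]
      refine (div_le_self (abs_nonneg _) (by simp)).trans ?_
      have : (j : ℝ) ^ 2 ≤ s ^ 2 := by gcongr; linarith
      have : (s : ℝ) ≤ s ^ 2 := le_self_pow₀ hs1 (by norm_num)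
      rw [abs_le]
      constructor <;> nlinarith
    -- The crude bound and the main term are together at most `2048 s² + 3 + 23 s² ≤ 2100 s²`, and
    -- `(N + 1)² ≤ 65536 s⁴`.
    have h3 : 2100 * (s : ℝ) ^ 2 ≤ 200000000 * (s : ℝ) ^ 6 / ((N : ℝ) + 1) ^ 2 := by
      rw [le_div_iff₀ (by positivity)]
      calc 2100 * (s : ℝ) ^ 2 * ((N : ℝ) + 1) ^ 2
          ≤ 2100 * (s : ℝ) ^ 2 * (256 * (s : ℝ) ^ 2) ^ 2 := by gcongr
        _ = 2100 * 65536 * (s : ℝ) ^ 6 := by ring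
        _ ≤ _ := by gcongr; norm_num
    refine le_trans ?_ h3
    have : (1 : ℝ) ≤ (s : ℝ) ^ 2 := one_le_pow₀ hs1
    rw [abs_le] at h1 h2 ⊢
    constructor <;> linarith [h1.1, h1.2, h2.1, h2.2]

/-! ### Summation over `j` and the error term -/

/-- The quadratic polynomial in `j` is written in the basis `1`, `j + 1`, `(j + 2).choose 2`, whose
power series are powers of `1 / (1 - y)`. -/
lemma hasSum_mainTerms {y : ℝ} (hy : |y| < 1) (k : ℕ) (n : ℝ) :
    HasSum (fun j : ℕ => y ^ j *
      (3 + (6 * ((k * (j + 1) : ℕ) : ℝ) - 27 * (j : ℝ) ^ 2 - 39 * j - 20) / 4 / n))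
      ((3 - 2 / n) * (1 / (1 - y)) + (6 * k + 42) / 4 / n * (1 / (1 - y) ^ 2)
        - 27 / 2 / n * (1 / (1 - y) ^ 3)) := by
  have h0 := (hasSum_choose_mul_geometric_of_norm_lt_one 0 hy).mul_left (3 - 2 / n)
  have h1 := (hasSum_choose_mul_geometric_of_norm_lt_one 1 hy).mul_left ((6 * k + 42) / 4 / n)
  have h2 := (hasSum_choose_mul_geometric_of_norm_lt_one 2 hy).mul_left (27 / 2 / n)
  have h := (h0.add h1).sub h2
  simp only [zero_add, pow_one, Nat.reduceAdd] at h
  refine h.congr_fun ?_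
  intro j
  rw [Nat.cast_choose_two]
  simp only [Nat.choose_zero_right, Nat.choose_one_right]
  push_cast
  ring

/-- The finite sum is extended by zeros, so that it can be compared termwise with the infinite
series of main terms. -/
lemma hasSum_toReal_vertexProtectionLaw (N : ℕ) (hn : 0 < N + 1) (k : ℕ) :
    HasSum (fun j => (-1) ^ j * ballotCoeff (N + 1) (k * (j + 1) + j + 1) (3 * j + 2) /
      N.centralBinom) ((vertexProtectionLaw (N + 1) hn).toMeasure {m : ℕ | k ≤ m}).toReal := by
  rw [toReal_vertexProtectionLaw, coeff_treeSeries_protectedCount,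
    coeff_treeSeries_protectedCount_zero, Finset.sum_div]
  have e (j : ℕ) : (k + 1) * (j + 1) = k * (j + 1) + j + 1 := by ring
  simp only [e]
  refine hasSum_sum_of_ne_finset_zero fun j hj => ?_
  rw [Finset.mem_range, not_lt] at hj
  rw [ballotCoeff_of_lt (by omega), mul_zero, zero_div]

lemma exists_abs_tail_sub_le : ∃ A : ℝ, 0 ≤ A ∧ ∀ (N : ℕ) (hn : 0 < N + 1) (k : ℕ), 1 ≤ k →
    |((vertexProtectionLaw (N + 1) hn).toMeasure {m : ℕ | k ≤ m}).toReal
      - (3 / ((4 : ℝ) ^ k + 2)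
        + ((3 * (k : ℝ) - 10) * (4 : ℝ) ^ (2 * k) + (6 * (k : ℝ) + 26) * (4 : ℝ) ^ k - 16)
            / (2 * ((4 : ℝ) ^ k + 2) ^ 3) * (1 / ((N : ℝ) + 1)))|
      ≤ A * ((k : ℝ) ^ 6 / ((4 : ℝ) ^ k * ((N : ℝ) + 1) ^ 2)) := by
  have hsummable : Summable fun j : ℕ => ((j : ℝ) + 1) ^ 6 * (1 / 2 : ℝ) ^ j := by
    have h := (summable_nat_add_iff (f := fun j : ℕ => (j : ℝ) ^ 6 * (1 / 2 : ℝ) ^ j) 1).2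
      (summable_pow_mul_geometric_of_norm_lt_one 6
      (show ‖(1 / 2 : ℝ)‖ < 1 by norm_num))
    refine (h.mul_left 2).congr fun j => ?_
    push_cast
    ring
  refine ⟨200000000 * ∑' j : ℕ, ((j : ℝ) + 1) ^ 6 * (1 / 2 : ℝ) ^ j,
    mul_nonneg (by norm_num) (tsum_nonneg fun j => by positivity), fun N hn k hk => ?_⟩
  set q : ℝ := 4 ^ k with hq
  have hq4 : 4 ≤ q := by
    rw [hq]
    exact le_self_pow₀ (by norm_num) (by omega)
  have hq0 : 0 < q := by linarith
  have hy : |(-(2 / q))| ≤ 1 / 2 := by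
    rw [abs_neg, abs_of_pos (by positivity), div_le_div_iff₀ hq0 (by norm_num)]
    linarith
  have hmain := (hasSum_mainTerms (hy.trans_lt (by norm_num)) k ((N : ℝ) + 1)).mul_left q⁻¹
  have hval : q⁻¹ * ((3 - 2 / ((N : ℝ) + 1)) * (1 / (1 - -(2 / q))) +
      (6 * k + 42) / 4 / ((N : ℝ) + 1) * (1 / (1 - -(2 / q)) ^ 2) -
      27 / 2 / ((N : ℝ) + 1) * (1 / (1 - -(2 / q)) ^ 3)) =
      3 / (q + 2) + ((3 * (k : ℝ) - 10) * (4 : ℝ) ^ (2 * k) + (6 * (k : ℝ) + 26) * q - 16)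
            / (2 * (q + 2) ^ 3) * (1 / ((N : ℝ) + 1)) := by
    have h1 : 1 - -(2 / q) = (q + 2) / q := by
      field_simp
      ring
    rw [h1, show (4 : ℝ) ^ (2 * k) = q ^ 2 by rw [hq, ← pow_mul, mul_comm]]
    field_simp
    ring
  rw [hval] at hmain
  have hdiff := (hasSum_toReal_vertexProtectionLaw N hn k).sub hmain
  have hbound := (hsummable.mul_left (200000000 * ((k : ℝ) ^ 6 / (q * ((N : ℝ) + 1) ^ 2)))).hasSum
  rw [tsum_mul_left] at hbound
  have hle := hdiff.norm_le_of_bounded hbound fun j => ?_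
  · rw [Real.norm_eq_abs] at hle
    refine hle.trans (le_of_eq ?_)
    ring
  have hjs : j + 1 ≤ k * (j + 1) := Nat.le_mul_of_pos_left _ hk
  obtain ⟨r, hr⟩ : ∃ r, r + j = 2 * (k * (j + 1)) := ⟨2 * (k * (j + 1)) - j, by omega⟩
  have hterm := abs_ballotCoeff_div_sub_le (N := N) hjs hr
  -- As `r = 2 k (j + 1) - j`, the weight `2^(-r)` equals `q⁻¹ (2 / q)^j`, and `2 / q ≤ 1/2` because
  -- `k ≥ 1`.
  have hpow : (2 : ℝ) ^ r * (2 / q) ^ j = q := by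
    have h2 : (2 : ℝ) ^ r * 2 ^ j = q * q ^ j := by
      rw [← pow_add, hr, pow_mul, pow_mul, ← pow_succ', hq]
      norm_num
    rw [div_pow, mul_div_assoc', h2]
    field_simp
  have e : (-1) ^ j * ballotCoeff (N + 1) (k * (j + 1) + j + 1) (3 * j + 2) / N.centralBinom =
      q⁻¹ * (-(2 / q)) ^ j *
      (2 ^ r * ballotCoeff (N + 1) (k * (j + 1) + j + 1) (3 * j + 2) / N.centralBinom) := by
    rw [neg_pow (2 / q), show q⁻¹ * ((-1) ^ j * (2 / q) ^ j) * (2 ^ r *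
      ballotCoeff (N + 1) (k * (j + 1) + j + 1) (3 * j + 2) / N.centralBinom) =
      (q⁻¹ * (2 ^ r * (2 / q) ^ j)) * ((-1) ^ j *
      ballotCoeff (N + 1) (k * (j + 1) + j + 1) (3 * j + 2) / N.centralBinom) by ring, hpow,
      inv_mul_cancel₀ hq0.ne', one_mul]
  rw [e, ← mul_assoc q⁻¹, ← mul_sub, Real.norm_eq_abs, abs_mul]
  have hc : |q⁻¹ * (-(2 / q)) ^ j| ≤ q⁻¹ * (1 / 2) ^ j := by
    rw [abs_mul, abs_of_pos (inv_pos.2 hq0), abs_pow]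
    gcongr
  calc _ ≤ (q⁻¹ * (1 / 2) ^ j) *
      (200000000 * ((k * (j + 1) : ℕ) : ℝ) ^ 6 / ((N : ℝ) + 1) ^ 2) :=
        mul_le_mul hc hterm (abs_nonneg _) (by positivity)
    _ = _ := by
      push_cast
      field_simp

lemma exists_pow_four_mul_le : ∃ B : ℝ, ∀ k : ℕ, (k : ℝ) ^ 4 * (3 / 4 : ℝ) ^ k ≤ B := by
  obtain ⟨B, hB⟩ := (tendsto_pow_const_mul_const_pow_of_abs_lt_one 4
    (show |(3 / 4 : ℝ)| < 1 by rw [abs_lt]; constructor <;> norm_num)).bddAbove_range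
  exact ⟨B, fun k => hB ⟨k, rfl⟩⟩

lemma toReal_vertexProtectionLaw_zero (n : ℕ) (hn : 0 < n) :
    ((vertexProtectionLaw n hn).toMeasure {m : ℕ | 0 ≤ m}).toReal = 1 := by
  simp

end PlaneTree

theorem mainTheorem4 :
    ∃ C : ℝ, ∀ (n : ℕ) (hn : 0 < n) (k : ℕ),
      |((PlaneTree.vertexProtectionLaw n hn).toMeasure {m : ℕ | k ≤ m}).toReal
          - (3 / ((4 : ℝ) ^ k + 2)
            + ((3 * (k : ℝ) - 10) * (4 : ℝ) ^ (2 * k) + (6 * (k : ℝ) + 26) * (4 : ℝ) ^ k - 16)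
                / (2 * ((4 : ℝ) ^ k + 2) ^ 3) * (1 / (n : ℝ)))|
        ≤ C * ((k : ℝ) ^ 2 / ((3 : ℝ) ^ k * (n : ℝ) ^ 2)) := by
  obtain ⟨A, hA, h⟩ := PlaneTree.exists_abs_tail_sub_le
  obtain ⟨B, hB⟩ := PlaneTree.exists_pow_four_mul_le
  refine ⟨A * B, fun n hn k => ?_⟩
  -- For `k = 0` the error bound is zero, and the formula is exact: `3 / 3 = 1` and `-10 + 26 - 16 =
  -- 0`.
  rcases Nat.eq_zero_or_pos k with rfl | hk
  · rw [PlaneTree.toReal_vertexProtectionLaw_zero]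
    norm_num
  obtain ⟨N, rfl⟩ := Nat.exists_eq_add_of_le' (show 1 ≤ n from hn)
  have h1 := h N hn k hk
  push_cast
  refine h1.trans ?_
  rw [mul_assoc]
  refine mul_le_mul_of_nonneg_left ?_ hA
  calc (k : ℝ) ^ 6 / ((4 : ℝ) ^ k * ((N : ℝ) + 1) ^ 2)
      = ((k : ℝ) ^ 4 * (3 / 4 : ℝ) ^ k) * ((k : ℝ) ^ 2 / ((3 : ℝ) ^ k * ((N : ℝ) + 1) ^ 2)) := by
        rw [div_pow]
        field_simp
    _ ≤ B * ((k : ℝ) ^ 2 / ((3 : ℝ) ^ k * ((N : ℝ) + 1) ^ 2)) := by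
        gcongr
        exact hB k
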